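/- Consider $n\ge 1$ agents $\mathcal V=\{1,\dots,n\}$ and convex (not necessarily differentiable) functions $f_i:\mathbb R^d\to\mathbb R$, $i\in\mathcal V$. Let $f(z)=\frac1n\sum_{i=1}^n f_i(z)$, and suppose that the set $\mathcal Z$ of minimizers of $f$ is nonempty and bounded. For $t=0,1,2,\dots$ let $\mathbb G(t)=(\mathcal V,\mathcal E(t))$ be a directed graph with a self-arc at every vertex; put $\mathcal N_i(t)=\{j:(j,i)\in\mathcal E(t)\}$ and $\mathcal N_i^-(t)=\{k:(i,k)\in\mathcal E(t)\}$. Let $w_{ij}(t)$, $j\in\mathcal N_i(t)$, be weights for which there is a constant $\beta>0$ with $w_{ij}(t)\ge\beta$ for all $t$, $i$ and $j\in\mathcal N_i(t)$, and $\sum_{j\in\mathcal N_i^-(t)}w_{ji}(t)=1$ for all $i$ and $t$. Given initial values $x_i(0)\in\mathbb R^d$, step sizes $\alpha(t)$ and arbitrary switching signals $\sigma_i(t)\in\{0,1\}$, the heterogeneous distributed subgradient algorithm is $$x_i(t+1)=\sum_{j\in\mathcal N_i(t)}w_{ij}(t)\big[x_j(t)-\alpha(t)g_j(t)\sigma_j(t)\big]-\alpha(t)g_i(t)\big(1-\sigma_i(t)\big),$$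 $$y_i(t+1)=\sum_{j\in\mathcal N_i(t)}w_{ij}(t)y_j(t),\qquad y_i(0)=1,$$ where, with $z_i(t)=x_i(t)/y_i(t)$, the vector $g_i(t)$ is any subgradient of $f_i$ at $z_i(t)$, i.e. $f_i(u)\ge f_i(z_i(t))+g_i(t)^\top(u-z_i(t))$ for all $u\in\mathbb R^d$. Let $\bar z(t)=\frac1n\sum_{i=1}^n z_i(t)$. Suppose that $\{\mathbb G(t)\}$ is uniformly strongly connected, i.e. there is a positive integer $L$ such that for every $t\ge0$ the union graph $\bigcup_{k=t}^{t+L-1}\mathbb G(k)$ is strongly connected, and that the Euclidean norms $\|g_i(t)\|$ are uniformly bounded for all $i$ and $t$. Let $z^*\in\mathcal Z$. 1) If the step sizes are positive and nonincreasing with $\sum_{t=0}^\infty\alpha(t)=\infty$ and $\sum_{t=0}^\infty\alpha^2(t)<\infty$, then $$\lim_{t\to\infty}f\bigg(\frac{\sum_{\tau=0}^t\alpha(\tau)\bar z(\tau)}{\sum_{\tau=0}^t\alpha(\tau)}\bigg)=f(z^*),\qquad \lim_{t\to\infty}f\bigg(\frac{\sum_{\tau=0}^t\alpha(\tau)z_k(\tau)}{\sum_{\tau=0}^t\alpha(\tau)}\bigg)=f(z^*)\quad\text{for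 every }k\in\mathcal V.$$ 2) Fix the functions, the graphs, the weights, the initial values and a number $G$. There is a constant $C$, independent of $T$, such that for every integer $T>0$, every run of the algorithm with the fixed step size $\alpha(t)=1/\sqrt T$ for $t\in\{0,\dots,T-1\}$, any switching signals, and any subgradients with $\|g_i(t)\|\le G$ for all $i\in\mathcal V$ and $t\in\{0,\dots,T-1\}$ satisfies $$f\bigg(\frac{\sum_{\tau=0}^{T-1}\bar z(\tau)}{T}\bigg)-f(z^*)\le\frac{C}{\sqrt T},\qquad f\bigg(\frac{\sum_{\tau=0}^{T-1}z_k(\tau)}{T}\bigg)-f(z^*)\le\frac{C}{\sqrt T}\quad\text{for every }k\in\mathcal V.$$ -/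

import Mathlib

open Filter Topology

noncomputable section

namespace HeterogeneousSubgradient

/-- A directed graph is strongly connected if there is a directed path from any vertex to any
other vertex. -/
def StronglyConnected {V : Type*} (H : Digraph V) : Prop :=
  ∀ i j : V, Relation.ReflTransGen H.Adj i j

/-- A sequence of directed graphs on a common vertex set is uniformly strongly connected if, for
some positive integer `L`, the union of any `L` consecutive graphs is strongly connected. -/
def UniformlyStronglyConnected {V : Type*} (𝔾 : ℕ → Digraph V) : Prop :=
  ∃ L : ℕ, 0 < L ∧ ∀ t : ℕ, StronglyConnected (⨆ k ∈ Set.Ico t (t + L), 𝔾 k)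

/-- The weights of the push-sum updates: `W t i j` is the weight `w_{ij}(t)` that is put on the
arc from `j` to `i` at time `t`. It vanishes when `(j, i)` is not an arc, the weights on
arcs are bounded below by a positive constant, and the columns sum to one. -/
structure PushSumWeights {n : ℕ} (𝔾 : ℕ → Digraph (Fin n))
    (W : ℕ → Matrix (Fin n) (Fin n) ℝ) : Prop where
  zero_of_not_adj : ∀ t i j, ¬ (𝔾 t).Adj j i → W t i j = 0
  lower_bound : ∃ β : ℝ, 0 < β ∧ ∀ t i j, (𝔾 t).Adj j i → β ≤ W t i j
  column_sum : ∀ t j, ∑ i, W t i j = 1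

/-- Diminishing step sizes: positive, nonincreasing, not summable, square summable. -/
structure DiminishingSteps (α : ℕ → ℝ) : Prop where
  pos : ∀ t, 0 < α t
  antitone : Antitone α
  sum_eq_top : Tendsto (fun t : ℕ => ∑ τ ∈ Finset.range t, α τ) atTop atTop
  summable_sq : Summable (fun t => α t ^ 2)

/-- `v` is a subgradient of `h` at `x`. -/
def IsSubgradient {d : ℕ} (h : EuclideanSpace ℝ (Fin d) → ℝ)
    (v x : EuclideanSpace ℝ (Fin d)) : Prop :=
  ∀ y, h x + inner ℝ v (y - x) ≤ h y

/-- The cost function `f(z) = (1/n) ∑ᵢ fᵢ(z)`. -/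
def cost {n d : ℕ} (f : Fin n → EuclideanSpace ℝ (Fin d) → ℝ)
    (z : EuclideanSpace ℝ (Fin d)) : ℝ :=
  (1 / (n : ℝ)) * ∑ i, f i z

/-- The set of optimal solutions of the cost function. -/
def optimalSet {n d : ℕ} (f : Fin n → EuclideanSpace ℝ (Fin d) → ℝ) :
    Set (EuclideanSpace ℝ (Fin d)) :=
  {z | ∀ u, cost f z ≤ cost f u}

/-- The variables `yᵢ(t)`: `yᵢ(0) = 1` and `yᵢ(t+1) = ∑ⱼ w_{ij}(t) yⱼ(t)`. -/
def ySeq {n : ℕ} (W : ℕ → Matrix (Fin n) (Fin n) ℝ) : ℕ → Fin n → ℝ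
  | 0, _ => 1
  | t + 1, i => ∑ j, W t i j * ySeq W t j

/-- The variables `xᵢ(t)` of the heterogeneous algorithm with weights `W`, step sizes `α`,
switching signals `σ`, directions `g` and initial values `x0`:
`xᵢ(t+1) = ∑ⱼ w_{ij}(t) [xⱼ(t) - α(t) gⱼ(t) σⱼ(t)] - α(t) gᵢ(t) (1 - σᵢ(t))`. -/
def xSeq {n d : ℕ} (W : ℕ → Matrix (Fin n) (Fin n) ℝ) (α : ℕ → ℝ) (σ : ℕ → Fin n → ℝ)
    (g : ℕ → Fin n → EuclideanSpace ℝ (Fin d)) (x0 : Fin n → EuclideanSpace ℝ (Fin d)) :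
    ℕ → Fin n → EuclideanSpace ℝ (Fin d)
  | 0, i => x0 i
  | t + 1, i =>
      ∑ j, W t i j • (xSeq W α σ g x0 t j - (α t * σ t j) • g t j)
        - (α t * (1 - σ t i)) • g t i

/-- The ratios `zᵢ(t) = xᵢ(t) / yᵢ(t)`. -/
def zSeq {n d : ℕ} (W : ℕ → Matrix (Fin n) (Fin n) ℝ) (α : ℕ → ℝ) (σ : ℕ → Fin n → ℝ)
    (g : ℕ → Fin n → EuclideanSpace ℝ (Fin d)) (x0 : Fin n → EuclideanSpace ℝ (Fin d))
    (t : ℕ) (i : Fin n) : EuclideanSpace ℝ (Fin d) :=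
  (ySeq W t i)⁻¹ • xSeq W α σ g x0 t i

/-- The averages `z̄(t) = (1/n) ∑ᵢ zᵢ(t)`. -/
def zBar {n d : ℕ} (W : ℕ → Matrix (Fin n) (Fin n) ℝ) (α : ℕ → ℝ) (σ : ℕ → Fin n → ℝ)
    (g : ℕ → Fin n → EuclideanSpace ℝ (Fin d)) (x0 : Fin n → EuclideanSpace ℝ (Fin d))
    (t : ℕ) : EuclideanSpace ℝ (Fin d) :=
  (1 / (n : ℝ)) • ∑ i, zSeq W α σ g x0 t i

/-- The weighted running average `(∑_{τ<m} α(τ) u(τ)) / (∑_{τ<m} α(τ))`. -/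
def weightedAvg {d : ℕ} (α : ℕ → ℝ) (u : ℕ → EuclideanSpace ℝ (Fin d)) (m : ℕ) :
    EuclideanSpace ℝ (Fin d) :=
  (∑ τ ∈ Finset.range m, α τ)⁻¹ • ∑ τ ∈ Finset.range m, α τ • u τ

/-- The uniform average `(∑_{τ<m} u(τ)) / m`. -/
def uniformAvg {d : ℕ} (u : ℕ → EuclideanSpace ℝ (Fin d)) (m : ℕ) :
    EuclideanSpace ℝ (Fin d) :=
  (m : ℝ)⁻¹ • ∑ τ ∈ Finset.range m, u τ

end HeterogeneousSubgradient

end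

open HeterogeneousSubgradient

/-! Since the columns of `W` sum to one, the switching signals cancel in the mean p(t) = (1/n) ∑
xᵢ(t) (`sum_perturbation`): p(t+1) = p(t) - (α(t)/n) ∑ gᵢ(t). The scheme is thus a centralized
subgradient method whose subgradients are taken at zᵢ instead of p.

The distance from zᵢ to p is controlled by mixing. Transition matrices over windows of length `n *
L` have entries bounded below, so their columns approach multiples of y at a summable rate
(`exists_mixing_rate`). Variation of constants turns this into an error e(t) that is a summable term
plus a convolution of the rate with the step sizes (`norm_ratio_sub_mean_le`), and ∑ α e ≤ const ·
(1 + ∑ α²) by `sum_mul_sum_kernel_le`.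

Subgradients are bounded only at the zᵢ, so comparing costs at p, zᵢ and the output points needs a
Lipschitz constant on a bounded set. Boundedness of the minimizers supplies it: far from `zstar` a
step cannot increase the distance of p to `zstar` (`exists_radius_le_sum`), so all points stay in a
ball fixed before the run. Telescoping the descent inequality gives ∑ α (f(v) - f(zstar)) ≤ C (1 + ∑
α²) in `exists_sum_gap_le`, for any v(t) lying in every closed ball that contains all zᵢ(t); this
covers both zₖ and z̄. Jensen's inequality and division by ∑ α give both claims. -/

namespace HeterogeneousSubgradient

variable {n d : ℕ}

/-! ### Products of column-stochastic matrices: positivity and mixing. -/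

/-- The product `W (s + k - 1) * ⋯ * W s` of `k` consecutive weight matrices. -/
noncomputable def transition (W : ℕ → Matrix (Fin n) (Fin n) ℝ) (s : ℕ) :
    ℕ → Matrix (Fin n) (Fin n) ℝ
  | 0 => 1
  | k + 1 => W (s + k) * transition W s k

lemma PushSumWeights.nonneg {𝔾 : ℕ → Digraph (Fin n)} {W : ℕ → Matrix (Fin n) (Fin n) ℝ}
    (hW : PushSumWeights 𝔾 W) (t : ℕ) (i j : Fin n) : 0 ≤ W t i j := by
  obtain ⟨β, hβ, h⟩ := hW.lower_bound
  by_cases ha : (𝔾 t).Adj j i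
  · exact hβ.le.trans (h t i j ha)
  · exact (hW.zero_of_not_adj t i j ha).ge

section Transition

variable {W : ℕ → Matrix (Fin n) (Fin n) ℝ}

lemma transition_nonneg (h0 : ∀ t i j, 0 ≤ W t i j) (s k : ℕ) (i j : Fin n) :
    0 ≤ transition W s k i j := by
  induction k generalizing i with
  | zero => by_cases h : i = j <;> simp [transition, Matrix.one_apply, h]
  | succ k ih =>
    simp only [transition, Matrix.mul_apply]
    exact Finset.sum_nonneg fun l _ => mul_nonneg (h0 _ _ _) (ih l)

lemma sum_transition (h1 : ∀ t j, ∑ i, W t i j = 1) (s k : ℕ) (j : Fin n) :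
    ∑ i, transition W s k i j = 1 := by
  induction k with
  | zero => simp [transition, Matrix.one_apply]
  | succ k ih =>
    simp only [transition, Matrix.mul_apply]
    rw [Finset.sum_comm]
    simp only [← Finset.sum_mul, h1, one_mul, ih]

lemma transition_add (s k m : ℕ) :
    transition W s (k + m) = transition W (s + k) m * transition W s k := by
  induction m with
  | zero => simp [transition]
  | succ m ih => rw [← add_assoc, transition, ih, transition, Matrix.mul_assoc, add_assoc]

lemma ySeq_add (s k : ℕ) (i : Fin n) :
    ySeq W (s + k) i = ∑ j, transition W s k i j * ySeq W s j := by
  induction k generalizing i with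
  | zero => simp [transition, Matrix.one_apply]
  | succ k ih =>
    rw [← add_assoc, ySeq]
    simp only [ih, transition, Matrix.mul_apply, Finset.mul_sum, Finset.sum_mul]
    rw [Finset.sum_comm]
    simp only [mul_assoc]

lemma ySeq_nonneg (h0 : ∀ t i j, 0 ≤ W t i j) (t : ℕ) (i : Fin n) : 0 ≤ ySeq W t i := by
  induction t generalizing i with
  | zero => simp [ySeq]
  | succ t ih => exact Finset.sum_nonneg fun j _ => mul_nonneg (h0 _ _ _) (ih j)

lemma sum_ySeq (h1 : ∀ t j, ∑ i, W t i j = 1) (t : ℕ) : ∑ i, ySeq W t i = n := by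
  induction t with
  | zero => simp [ySeq]
  | succ t ih =>
    simp only [ySeq]
    rw [Finset.sum_comm]
    simp only [← Finset.sum_mul, h1, one_mul, ih]

lemma ySeq_le (h0 : ∀ t i j, 0 ≤ W t i j) (h1 : ∀ t j, ∑ i, W t i j = 1) (t : ℕ) (i : Fin n) :
    ySeq W t i ≤ n := by
  rw [← sum_ySeq h1 t]
  exact Finset.single_le_sum (fun j _ => ySeq_nonneg h0 t j) (Finset.mem_univ i)

lemma pow_succ_le_transition {β : ℝ} (h0 : ∀ t i j, 0 ≤ W t i j) (hβ : 0 ≤ β)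
    {s k : ℕ} {i l j : Fin n} (hl : β ^ k ≤ transition W s k l j) (hw : β ≤ W (s + k) i l) :
    β ^ (k + 1) ≤ transition W s (k + 1) i j := by
  simp only [transition, Matrix.mul_apply]
  calc β ^ (k + 1) = β * β ^ k := pow_succ' _ _
    _ ≤ W (s + k) i l * transition W s k l j := mul_le_mul hw hl (by positivity) (h0 _ _ _)
    _ ≤ _ := Finset.single_le_sum
      (f := fun l => W (s + k) i l * transition W s k l j)
      (fun l _ => mul_nonneg (h0 _ _ _) (transition_nonneg h0 _ _ _ _)) (Finset.mem_univ l)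

/-- Self-arcs prolong any path by waiting at its end, so a reached index stays reached. -/
lemma pow_le_transition_mono {β : ℝ} (h0 : ∀ t i j, 0 ≤ W t i j) (hβ : 0 ≤ β)
    (hd : ∀ t i, β ≤ W t i i) {s k : ℕ} {i j : Fin n} (h : β ^ k ≤ transition W s k i j)
    {k' : ℕ} (hk : k ≤ k') : β ^ k' ≤ transition W s k' i j := by
  induction k', hk using Nat.le_induction with
  | base => exact h
  | succ m _ ih => exact pow_succ_le_transition h0 hβ ih (hd _ _)

/-- Over a window of length `n * L` all entries of the transition matrix are positive: the set
of indices that a given column has reached grows by at least one every `L` steps. -/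
lemma pow_le_transition {𝔾 : ℕ → Digraph (Fin n)} {β : ℝ} (h0 : ∀ t i j, 0 ≤ W t i j)
    (hβ : 0 ≤ β) (hself : ∀ t i, (𝔾 t).Adj i i) (hb : ∀ t i j, (𝔾 t).Adj j i → β ≤ W t i j)
    {L : ℕ} (hL : ∀ t : ℕ, StronglyConnected (⨆ k ∈ Set.Ico t (t + L), 𝔾 k))
    (s : ℕ) (i j : Fin n) : β ^ (n * L) ≤ transition W s (n * L) i j := by
  classical
  have hd : ∀ t i, β ≤ W t i i := fun t i => hb t i i (hself t i)
  let R : ℕ → Finset (Fin n) := fun k => {i | β ^ k ≤ transition W s k i j}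
  have hmem : ∀ k i, i ∈ R k ↔ β ^ k ≤ transition W s k i j := fun k i => by simp [R]
  have hmono : ∀ {k k'}, k ≤ k' → R k ⊆ R k' := fun hk i hi =>
    (hmem _ _).2 (pow_le_transition_mono h0 hβ hd ((hmem _ _).1 hi) hk)
  have hj : ∀ k, j ∈ R k := fun k => hmono (Nat.zero_le k) ((hmem _ _).2 (by simp [transition]))
  have hgrow : ∀ k, R k = Finset.univ ∨ (R k).card + 1 ≤ (R (k + L)).card := by
    intro k
    by_contra! hcon
    have heq : R k = R (k + L) := Finset.eq_of_subset_of_card_le (hmono (by lia)) (by lia)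
    refine hcon.1 (Finset.eq_univ_of_forall fun i => ?_)
    -- Without growth, `R k` is closed under the arcs of the window: `a` is still reached when its
    -- arc to `c` appears, so `c` lies in `R (k + L) = R k`. Strong connectivity then carries `j` to
    -- every `i`.
    refine Relation.ReflTransGen.head_induction_on
      (motive := fun a _ => a ∈ R k → i ∈ R k) (hL (s + k) j i) id ?_ (hj k)
    intro a c hac _ ih ha
    simp only [Digraph.iSup_adj] at hac
    obtain ⟨t, ht, hac⟩ := hac
    obtain ⟨ht1, ht2⟩ := ht
    apply ih
    rw [heq]
    obtain ⟨q, rfl⟩ := Nat.exists_eq_add_of_le ht1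
    have hq : a ∈ R (k + q) := hmono (by lia) ha
    refine hmono (show k + q + 1 ≤ k + L by lia) ((hmem _ _).2 ?_)
    exact pow_succ_le_transition h0 hβ ((hmem _ _).1 hq) (by rw [← add_assoc]; exact hb _ _ _ hac)
  have hcard : ∀ q, R (q * L) = Finset.univ ∨ q + 1 ≤ (R (q * L)).card := by
    intro q
    induction q with
    | zero => right; exact Finset.card_pos.2 ⟨j, hj _⟩
    | succ q ih =>
      have hs : R (q * L) ⊆ R ((q + 1) * L) := hmono (Nat.mul_le_mul_right L (by lia))
      rcases ih with h | h
      · left; rw [h] at hs; exact Finset.univ_subset_iff.1 hs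
      · rcases hgrow (q * L) with h' | h'
        · left; rw [h'] at hs; exact Finset.univ_subset_iff.1 hs
        · right; rw [Nat.succ_mul]; lia
  have huniv : R (n * L) = Finset.univ := by
    rcases hcard n with h | h
    · exact h
    · have := (R (n * L)).card_le_univ
      rw [Fintype.card_fin] at this
      lia
  exact (hmem _ _).1 (huniv ▸ Finset.mem_univ i)

/-- After time `m`, every agent receives at least `β ^ m` of the total mass `n` present `m` steps
earlier. Before that, self-weights alone retain `β ^ t ≥ β ^ m` of the initial value. -/
lemma pow_le_ySeq {β : ℝ} (h0 : ∀ t i j, 0 ≤ W t i j) (h1 : ∀ t j, ∑ i, W t i j = 1)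
    (hn : 0 < n) (hβ : 0 ≤ β) (hd : ∀ t i, β ≤ W t i i) {m : ℕ}
    (hm : ∀ s i j, β ^ m ≤ transition W s m i j) (t : ℕ) (i : Fin n) : β ^ m ≤ ySeq W t i := by
  have hn' : (1 : ℝ) ≤ n := by exact_mod_cast hn
  rcases le_total m t with h | h
  · obtain ⟨s, rfl⟩ := Nat.exists_eq_add_of_le' h
    rw [ySeq_add]
    calc β ^ m ≤ β ^ m * n := le_mul_of_one_le_right (by positivity) hn'
      _ = ∑ j, β ^ m * ySeq W s j := by rw [← Finset.mul_sum, sum_ySeq h1]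
      _ ≤ _ := Finset.sum_le_sum fun j _ =>
        mul_le_mul_of_nonneg_right (hm s i j) (ySeq_nonneg h0 s j)
  · have hβ1 : β ≤ 1 := by
      rw [← h1 0 i]
      exact (hd 0 i).trans (Finset.single_le_sum (f := fun k => W 0 k i)
        (fun j _ => h0 0 j i) (Finset.mem_univ i))
    refine (pow_le_pow_of_le_one hβ hβ1 h).trans ?_
    have := pow_le_transition_mono h0 hβ hd (s := 0) (k := 0) (i := i) (j := i)
      (by simp [transition]) (Nat.zero_le t)
    refine this.trans ?_
    have hy := ySeq_add (W := W) 0 t i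
    rw [zero_add] at hy
    rw [hy]
    simp only [ySeq, mul_one]
    exact Finset.single_le_sum (f := fun j => transition W 0 t i j)
      (fun j _ => transition_nonneg h0 _ _ _ _) (Finset.mem_univ i)

/-- A vector of zero sum that is dominated by `y` stays dominated by `y`, with the constant
contracted by the least entry of the transition matrix. -/
lemma abs_transition_mulVec_le (h0 : ∀ t i j, 0 ≤ W t i j) (h1 : ∀ t j, ∑ i, W t i j = 1)
    {s m : ℕ} {γ δ : ℝ} (hγ : 0 ≤ γ) (hm : ∀ i j, γ ≤ transition W s m i j) (hδ : 0 ≤ δ)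
    {v : Fin n → ℝ} (hv : ∑ i, v i = 0) (hvy : ∀ i, |v i| ≤ δ * ySeq W s i) (i : Fin n) :
    |∑ j, transition W s m i j * v j| ≤ (1 - γ) * δ * ySeq W (s + m) i := by
  have key : ∀ u : Fin n → ℝ, ∑ i, u i = 0 → (∀ i, |u i| ≤ δ * ySeq W s i) →
      -((1 - γ) * δ * ySeq W (s + m) i) ≤ ∑ j, transition W s m i j * u j := by
    intro u hu huy
    -- The vector `u + δ y` is nonnegative with total mass `δ n`, so each entry of its image is at
    -- least `γ δ n`, which dominates `γ δ y` because `y ≤ n`.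
    have h2 : ∑ j, γ * (u j + δ * ySeq W s j)
        ≤ ∑ j, transition W s m i j * (u j + δ * ySeq W s j) :=
      Finset.sum_le_sum fun j _ => mul_le_mul_of_nonneg_right (hm i j)
        (by linarith [neg_abs_le (u j), huy j])
    rw [← Finset.mul_sum, Finset.sum_add_distrib, ← Finset.mul_sum, hu, sum_ySeq h1] at h2
    have h3 : ∑ j, transition W s m i j * (u j + δ * ySeq W s j)
        = ∑ j, transition W s m i j * u j + δ * ySeq W (s + m) i := by
      rw [ySeq_add, Finset.mul_sum, ← Finset.sum_add_distrib]
      exact Finset.sum_congr rfl fun j _ => by ring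
    have h4 : γ * δ * ySeq W (s + m) i ≤ γ * δ * n :=
      mul_le_mul_of_nonneg_left (ySeq_le h0 h1 _ _) (by positivity)
    linarith
  refine abs_le.2 ⟨key v hv hvy, ?_⟩
  have := key (fun j => -v j) (by simp [hv]) (by simpa using hvy)
  simp only [mul_neg, Finset.sum_neg_distrib] at this
  linarith

/-- The columns of the transition matrices approach multiples of `y` geometrically. -/
lemma abs_transition_sub_le (h0 : ∀ t i j, 0 ≤ W t i j) (h1 : ∀ t j, ∑ i, W t i j = 1)
    (hn : 0 < n) {m : ℕ} (hm0 : 0 < m) {η : ℝ} (hη : 0 < η) (hη1 : η ≤ 1)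
    (hm : ∀ s i j, η ≤ transition W s m i j) (hy : ∀ t i, η ≤ ySeq W t i) (s k : ℕ)
    (i j : Fin n) :
    |transition W s k i j - ySeq W (s + k) i / n|
      ≤ (1 - η) ^ (k / m) * (1 / η + 1) * ySeq W (s + k) i := by
  have hn' : (1 : ℝ) ≤ n := by exact_mod_cast hn
  have hrec : ∀ k l i, transition W s (k + l) i j - ySeq W (s + (k + l)) i / n
      = ∑ a, transition W (s + k) l i a * (transition W s k a j - ySeq W (s + k) a / n) := by
    intro k l i
    rw [transition_add, ← add_assoc, ySeq_add, Matrix.mul_apply, Finset.sum_div,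
      ← Finset.sum_sub_distrib]
    exact Finset.sum_congr rfl fun a _ => by ring
  have hsum : ∀ k, ∑ a, (transition W s k a j - ySeq W (s + k) a / n) = 0 := by
    intro k
    rw [Finset.sum_sub_distrib, ← Finset.sum_div, sum_ySeq h1, sum_transition h1,
      div_self (by positivity), sub_self]
  have hbase : ∀ i, |transition W s 0 i j - ySeq W (s + 0) i / n|
      ≤ (1 / η + 1) * ySeq W (s + 0) i := by
    intro i
    have hyi := hy s i
    have hy0 : 0 < ySeq W s i := hη.trans_le hyi
    have ha : |transition W s 0 i j| ≤ 1 / η * ySeq W s i := by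
      have : |transition W s 0 i j| ≤ 1 := by
        by_cases h : i = j <;> simp [transition, Matrix.one_apply, h]
      refine this.trans ?_
      rw [one_div_mul_eq_div, le_div_iff₀ hη]
      linarith
    have hb : |ySeq W s i / n| ≤ ySeq W s i := by
      rw [abs_of_nonneg (by positivity)]
      exact div_le_self hy0.le hn'
    rw [add_zero]
    linarith [abs_sub (transition W s 0 i j) (ySeq W s i / n)]
  have hpos : 0 ≤ 1 / η + 1 := by positivity
  have h1η : 0 ≤ 1 - η := by linarith
  induction k using Nat.strong_induction_on generalizing i with
  | _ k ih =>
    rcases lt_or_ge k m with hk | hk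
    · rw [Nat.div_eq_of_lt hk, pow_zero, one_mul]
      -- Contraction constant zero: an incomplete window gains nothing but does not lose the bound
      -- either.
      have := abs_transition_mulVec_le h0 h1 le_rfl
        (fun i a => transition_nonneg h0 (s + 0) k i a) hpos (hsum 0) hbase i
      rw [← hrec] at this
      simpa using this
    · obtain ⟨q, rfl⟩ := Nat.exists_eq_add_of_le' hk
      rw [hrec, Nat.add_div_right _ hm0, pow_succ']
      refine (abs_transition_mulVec_le h0 h1 hη.le (hm _) (by positivity) (hsum q)
        (fun a => ih q (by lia) a) i).trans (le_of_eq ?_)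
      rw [add_assoc]
      ring

end Transition

/-- A shift by `m` multiplies the terms by `1 - γ`, so the sum S satisfies S ≤ m + (1 - γ) S. -/
lemma sum_pow_div_le {γ : ℝ} (hγ : 0 < γ) (hγ1 : γ ≤ 1) {m : ℕ} (hm : 0 < m) (N : ℕ) :
    ∑ k ∈ Finset.range N, (1 - γ) ^ (k / m) ≤ m / γ := by
  have h0 : ∀ k, 0 ≤ (1 - γ) ^ (k / m) := fun k => pow_nonneg (by linarith) _
  have h1 : ∑ k ∈ Finset.range N, (1 - γ) ^ (k / m)
      ≤ ∑ k ∈ Finset.range (m + N), (1 - γ) ^ (k / m) :=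
    Finset.sum_le_sum_of_subset_of_nonneg (Finset.range_mono (by lia)) fun k _ _ => h0 k
  rw [Finset.sum_range_add] at h1
  have h2 : ∑ k ∈ Finset.range m, (1 - γ) ^ (k / m) = m := by
    rw [Finset.sum_congr rfl fun k hk => by
      rw [Nat.div_eq_of_lt (Finset.mem_range.1 hk), pow_zero]]
    simp
  have h3 : ∑ k ∈ Finset.range N, (1 - γ) ^ ((m + k) / m)
      = (1 - γ) * ∑ k ∈ Finset.range N, (1 - γ) ^ (k / m) := by
    rw [Finset.mul_sum]
    exact Finset.sum_congr rfl fun k _ => by rw [Nat.add_div_left _ hm, pow_succ']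
  rw [h2, h3] at h1
  rw [le_div_iff₀ hγ]
  linarith

lemma exists_mixing_rate (hn : 0 < n) {𝔾 : ℕ → Digraph (Fin n)} (hself : ∀ t i, (𝔾 t).Adj i i)
    (hconn : UniformlyStronglyConnected 𝔾) {W : ℕ → Matrix (Fin n) (Fin n) ℝ}
    (hW : PushSumWeights 𝔾 W) :
    (∀ t i, 0 < ySeq W t i) ∧ ∃ ρ : ℕ → ℝ, (∀ k, 0 ≤ ρ k) ∧
      (∃ R, ∀ N, ∑ k ∈ Finset.range N, ρ k ≤ R) ∧
      ∀ s k i j, |transition W s k i j - ySeq W (s + k) i / n| ≤ ρ k * ySeq W (s + k) i := by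
  obtain ⟨β, hβ, hb⟩ := hW.lower_bound
  obtain ⟨L, hL0, hL⟩ := hconn
  have h0 := hW.nonneg
  have h1 := hW.column_sum
  have hd : ∀ t i, β ≤ W t i i := fun t i => hb t i i (hself t i)
  have hm := pow_le_transition h0 hβ.le hself hb hL
  have hm0 : 0 < n * L := Nat.mul_pos hn hL0
  have hβ1 : β ≤ 1 := by
    rw [← h1 0 ⟨0, hn⟩]
    exact (hd 0 _).trans (Finset.single_le_sum (f := fun k => W 0 k ⟨0, hn⟩)
      (fun j _ => h0 0 j _) (Finset.mem_univ _))
  have hη : 0 < β ^ (n * L) := by positivity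
  have hη1 : β ^ (n * L) ≤ 1 := pow_le_one₀ hβ.le hβ1
  have hy := pow_le_ySeq h0 h1 hn hβ.le hd hm
  refine ⟨fun t i => hη.trans_le (hy t i),
    fun k => (1 - β ^ (n * L)) ^ (k / (n * L)) * (1 / β ^ (n * L) + 1), fun k => ?_, ?_, ?_⟩
  · have : 0 ≤ 1 - β ^ (n * L) := by linarith
    positivity
  · refine ⟨((n * L : ℕ) : ℝ) / β ^ (n * L) * (1 / β ^ (n * L) + 1), fun N => ?_⟩
    rw [← Finset.sum_mul]
    exact mul_le_mul_of_nonneg_right (sum_pow_div_le hη hη1 hm0 N) (by positivity)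
  · exact abs_transition_sub_le h0 h1 hn hm0 hη hη1 hm hy

/-! ### Perturbed linear recursions and distance to the mean. -/

section Perturbed

variable {E : Type*} [NormedAddCommGroup E] [NormedSpace ℝ E]
  {W : ℕ → Matrix (Fin n) (Fin n) ℝ} {x δ : ℕ → Fin n → E}

/-- Variation of constants for a perturbed linear recursion. -/
lemma eq_transition_add_sum (hx : ∀ t i, x (t + 1) i = ∑ j, W t i j • x t j + δ t i)
    (t : ℕ) (i : Fin n) :
    x t i = ∑ j, transition W 0 t i j • x 0 j
      + ∑ s ∈ Finset.range t, ∑ j, transition W (s + 1) (t - 1 - s) i j • δ s j := by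
  induction t generalizing i with
  | zero => simp [transition, Matrix.one_apply]
  | succ t ih =>
    have h1 : ∑ j, transition W 0 (t + 1) i j • x 0 j
        = ∑ l, W t i l • ∑ j, transition W 0 t l j • x 0 j := by
      simp only [transition, Matrix.mul_apply, Finset.sum_smul, Finset.smul_sum, smul_smul,
        zero_add]
      exact Finset.sum_comm
    have h2 : ∀ s ∈ Finset.range t, ∑ j, transition W (s + 1) (t + 1 - 1 - s) i j • δ s j
        = ∑ l, W t i l • ∑ j, transition W (s + 1) (t - 1 - s) l j • δ s j := by
      intro s hs
      have hst := Finset.mem_range.1 hs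
      have e1 : t + 1 - 1 - s = (t - 1 - s) + 1 := by lia
      have e2 : s + 1 + (t - 1 - s) = t := by lia
      simp only [e1, transition, Matrix.mul_apply, Finset.sum_smul, Finset.smul_sum, smul_smul, e2]
      exact Finset.sum_comm
    have h3 : ∑ j, transition W (t + 1) (t + 1 - 1 - t) i j • δ t j = δ t i := by
      simp [transition, Matrix.one_apply]
    rw [hx, Finset.sum_range_succ, h1, h3, Finset.sum_congr rfl h2, Finset.sum_comm, ← add_assoc,
      ← Finset.sum_add_distrib]
    congr 1
    refine Finset.sum_congr rfl fun l _ => ?_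
    rw [ih l, smul_add, Finset.smul_sum (s := Finset.range t)]

lemma sum_eq_sum_add_sum (h1 : ∀ t j, ∑ i, W t i j = 1)
    (hx : ∀ t i, x (t + 1) i = ∑ j, W t i j • x t j + δ t i) (t : ℕ) :
    ∑ i, x (t + 1) i = ∑ i, x t i + ∑ i, δ t i := by
  simp only [hx, Finset.sum_add_distrib]
  rw [Finset.sum_comm]
  simp only [← Finset.sum_smul, h1, one_smul]

/-- Both `x t i` and `ySeq W t i` times the mean are linear in the same initial values and
perturbations, with coefficients differing by the mixing error. That error carries a factor y, which
the ratio cancels. -/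
lemma norm_ratio_sub_mean_le (h1 : ∀ t j, ∑ i, W t i j = 1) (hy : ∀ t i, 0 < ySeq W t i)
    {ρ : ℕ → ℝ} (hρ : ∀ s k i j,
      |transition W s k i j - ySeq W (s + k) i / n| ≤ ρ k * ySeq W (s + k) i)
    (hx : ∀ t i, x (t + 1) i = ∑ j, W t i j • x t j + δ t i) (t : ℕ) (i : Fin n) :
    ‖(ySeq W t i)⁻¹ • x t i - (1 / (n : ℝ)) • ∑ j, x t j‖
      ≤ ρ t * ∑ j, ‖x 0 j‖ + ∑ s ∈ Finset.range t, ρ (t - 1 - s) * ∑ j, ‖δ s j‖ := by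
  have hsum : ∀ t, ∑ i, x t i = ∑ i, x 0 i + ∑ s ∈ Finset.range t, ∑ j, δ s j := by
    intro t
    induction t with
    | zero => simp
    | succ t ih => rw [sum_eq_sum_add_sum h1 hx, ih, Finset.sum_range_succ, add_assoc]
  have hyi := hy t i
  set c := ySeq W t i / n with hc
  have hrep : x t i - ySeq W t i • (1 / (n : ℝ)) • ∑ j, x t j
      = ∑ j, (transition W 0 t i j - c) • x 0 j
        + ∑ s ∈ Finset.range t, ∑ j, (transition W (s + 1) (t - 1 - s) i j - c) • δ s j := by
    rw [smul_smul, mul_one_div, ← hc, hsum, eq_transition_add_sum hx]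
    simp only [sub_smul, Finset.sum_sub_distrib, ← Finset.smul_sum, smul_add]
    abel
  have hb : ∀ s k, s + k = t → ∀ v : Fin n → E,
      ‖∑ j, (transition W s k i j - c) • v j‖ ≤ ySeq W t i * (ρ k * ∑ j, ‖v j‖) := by
    rintro s k rfl v
    rw [Finset.mul_sum, Finset.mul_sum]
    refine norm_sum_le_of_le _ fun j _ => ?_
    rw [norm_smul, Real.norm_eq_abs]
    refine (mul_le_mul_of_nonneg_right (hρ s k i j) (norm_nonneg _)).trans (le_of_eq (by ring))
  have hmain : ‖x t i - ySeq W t i • (1 / (n : ℝ)) • ∑ j, x t j‖ ≤ ySeq W t i *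
      (ρ t * ∑ j, ‖x 0 j‖ + ∑ s ∈ Finset.range t, ρ (t - 1 - s) * ∑ j, ‖δ s j‖) := by
    rw [hrep, mul_add, Finset.mul_sum (s := Finset.range t)]
    refine (norm_add_le _ _).trans (add_le_add (hb 0 t (by lia) _) ?_)
    refine norm_sum_le_of_le _ fun s hs => hb _ _ ?_ _
    have := Finset.mem_range.1 hs
    lia
  have heq : (ySeq W t i)⁻¹ • x t i - (1 / (n : ℝ)) • ∑ j, x t j
      = (ySeq W t i)⁻¹ • (x t i - ySeq W t i • (1 / (n : ℝ)) • ∑ j, x t j) := by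
    rw [smul_sub, inv_smul_smul₀ hyi.ne']
  rw [heq, norm_smul, norm_inv, Real.norm_eq_abs, abs_of_pos hyi, inv_mul_le_iff₀ hyi]
  exact hmain

end Perturbed

/-! ### Kernel sums, convexity, and the descent inequality. -/

/-- The double sum of the step sizes against a summable kernel is controlled by the sum of their
squares. -/
lemma sum_mul_sum_kernel_le {T : ℕ} {α ρ : ℕ → ℝ} {R : ℝ} (hα : ∀ t < T, 0 ≤ α t)
    (hanti : ∀ s t, s ≤ t → t < T → α t ≤ α s) (hρ : ∀ k, 0 ≤ ρ k)
    (hR : ∀ N, ∑ k ∈ Finset.range N, ρ k ≤ R) :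
    ∑ t ∈ Finset.range T, α t * ∑ s ∈ Finset.range t, ρ (t - 1 - s) * α s
      ≤ R * ∑ t ∈ Finset.range T, α t ^ 2 := by
  calc ∑ t ∈ Finset.range T, α t * ∑ s ∈ Finset.range t, ρ (t - 1 - s) * α s
      ≤ ∑ t ∈ Finset.range T, ∑ s ∈ Finset.range t, α s ^ 2 * ρ (t - 1 - s) := by
        refine Finset.sum_le_sum fun t ht => ?_
        rw [Finset.mul_sum]
        refine Finset.sum_le_sum fun s hs => ?_
        have ht := Finset.mem_range.1 ht
        have hs := Finset.mem_range.1 hs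
        have h1 := mul_le_mul_of_nonneg_right (hanti s t hs.le ht)
          (mul_nonneg (hρ (t - 1 - s)) (hα s (hs.trans ht)))
        linarith
    _ = ∑ s ∈ Finset.range T, ∑ t ∈ Finset.Ico (s + 1) T, α s ^ 2 * ρ (t - 1 - s) := by
        refine Finset.sum_comm' fun t s => ?_
        simp only [Finset.mem_range, Finset.mem_Ico]
        lia
    _ ≤ ∑ s ∈ Finset.range T, α s ^ 2 * R := by
        refine Finset.sum_le_sum fun s _ => ?_
        rw [← Finset.mul_sum, Finset.sum_Ico_eq_sum_range]
        refine mul_le_mul_of_nonneg_left ?_ (sq_nonneg _)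
        refine le_trans (le_of_eq (Finset.sum_congr rfl fun k _ => ?_)) (hR (T - (s + 1)))
        congr 1
        lia
    _ = _ := by rw [← Finset.sum_mul, mul_comm]

lemma exists_lipschitz_of_convexOn {f : Fin n → EuclideanSpace ℝ (Fin d) → ℝ}
    (hf : ∀ i, ConvexOn ℝ Set.univ (f i)) (c : EuclideanSpace ℝ (Fin d)) (r : ℝ) :
    ∃ K : ℝ, 0 ≤ K ∧ ∀ i, ∀ u v, ‖u - c‖ ≤ r → ‖v - c‖ ≤ r → f i u - f i v ≤ K * ‖u - v‖ := by
  have h : ∀ i, ∃ K : NNReal, LipschitzOnWith K (f i) (Metric.closedBall c r) := fun i =>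
    LocallyLipschitzOn.exists_lipschitzOnWith_of_compact (isCompact_closedBall c r)
      (hf i).locallyLipschitz.locallyLipschitzOn
  choose K hK using h
  refine ⟨∑ i, (K i : ℝ), Finset.sum_nonneg fun i _ => (K i).2, fun i u v hu hv => ?_⟩
  have := (hK i).dist_le_mul u (mem_closedBall_iff_norm.2 hu) v (mem_closedBall_iff_norm.2 hv)
  rw [Real.dist_eq, dist_eq_norm] at this
  refine (le_abs_self _).trans (this.trans (mul_le_mul_of_nonneg_right ?_ (norm_nonneg _)))
  exact Finset.single_le_sum (f := fun i => (K i : ℝ)) (fun i _ => (K i).2) (Finset.mem_univ i)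

lemma cost_convexOn {f : Fin n → EuclideanSpace ℝ (Fin d) → ℝ}
    (hf : ∀ i, ConvexOn ℝ Set.univ (f i)) : ConvexOn ℝ Set.univ (cost f) := by
  refine ⟨convex_univ, fun x _ y _ a b ha hb hab => ?_⟩
  simp only [cost, smul_eq_mul]
  have : ∑ i, f i (a • x + b • y) ≤ ∑ i, (a * f i x + b * f i y) :=
    Finset.sum_le_sum fun i _ => (hf i).2 trivial trivial ha hb hab
  rw [Finset.sum_add_distrib, ← Finset.mul_sum, ← Finset.mul_sum] at this
  have h := mul_le_mul_of_nonneg_left this (show (0 : ℝ) ≤ 1 / n by positivity)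
  linarith

lemma sum_sub_eq_cost (hn : 0 < n) (f : Fin n → EuclideanSpace ℝ (Fin d) → ℝ)
    (u v : EuclideanSpace ℝ (Fin d)) : ∑ i, (f i u - f i v) = n * (cost f u - cost f v) := by
  have : (n : ℝ) ≠ 0 := by exact_mod_cast hn.ne'
  rw [cost, cost, Finset.sum_sub_distrib]
  field_simp

/-- Boundedness of the set of minimizers gives growth of the separate costs `f i (z i)`, as long
as the points `z i` stay close together. -/
lemma exists_radius_le_sum (hn : 0 < n) {f : Fin n → EuclideanSpace ℝ (Fin d) → ℝ}
    (hf : ∀ i, ConvexOn ℝ Set.univ (f i)) (hZ : Bornology.IsBounded (optimalSet f))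
    {zstar : EuclideanSpace ℝ (Fin d)} (hz : zstar ∈ optimalSet f) {B : ℝ} (hB : 0 ≤ B) (M : ℝ) :
    ∃ D : ℝ, ∀ (p : EuclideanSpace ℝ (Fin d)) (z : Fin n → EuclideanSpace ℝ (Fin d)),
      (∀ i, ‖z i - p‖ ≤ B) → D ≤ ‖p - zstar‖ → M ≤ ∑ i, (f i (z i) - f i zstar) := by
  have hn0 : (0 : ℝ) < n := by exact_mod_cast hn
  obtain ⟨r0, hr0⟩ := (Metric.isBounded_iff_subset_closedBall zstar).1 hZ
  -- This sphere lies strictly outside a ball containing all minimizers, so the cost gap has a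
  -- positive minimum `c` on it. It is empty when `d = 0`, where any `c` works.
  set r := max r0 0 + 1 with hr
  have hrpos : 0 < r := by positivity
  obtain ⟨K, hK0, hK⟩ := exists_lipschitz_of_convexOn hf zstar (r + B)
  have hc : ∃ c : ℝ, 0 < c ∧ ∀ u, ‖u - zstar‖ = r → c ≤ cost f u - cost f zstar := by
    rcases (Metric.sphere zstar r).eq_empty_or_nonempty with he | hne
    · refine ⟨1, one_pos, fun u hu => ?_⟩
      have : u ∈ Metric.sphere zstar r := mem_sphere_iff_norm.2 hu
      rw [he] at this
      exact this.elim
    · have hcont : Continuous (cost f) := (cost_convexOn hf).locallyLipschitz.continuous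
      obtain ⟨u0, hu0, hmin⟩ := (isCompact_sphere zstar r).exists_isMinOn hne hcont.continuousOn
      refine ⟨cost f u0 - cost f zstar, ?_, fun u hu => ?_⟩
      · by_contra! hle
        have : u0 ∈ optimalSet f := fun u => (by linarith [hz u])
        have h1 := mem_closedBall_iff_norm.1 (hr0 this)
        have h2 := mem_sphere_iff_norm.1 hu0
        linarith [le_max_left r0 0]
      · have := isMinOn_iff.1 hmin u (mem_sphere_iff_norm.2 hu)
        linarith
  obtain ⟨c, hc0, hc⟩ := hc
  -- Shrinking towards `zstar` by `θ = r / ‖p - zstar‖` puts `p` on the sphere and each `z i` within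
  -- `θ * B` of it. The Lipschitz loss is then `n * K * θ * B`, and the radius makes `θ * (|M| + n *
  -- K * B) ≤ n * c`.
  refine ⟨max r (r * (|M| + n * K * B) / (n * c)), fun p z hzp hD => ?_⟩
  set D := ‖p - zstar‖ with hDdef
  have hrD : r ≤ D := (le_max_left _ _).trans hD
  have hD2 : r * (|M| + n * K * B) ≤ D * (n * c) :=
    (div_le_iff₀ (by positivity)).1 ((le_max_right _ _).trans hD)
  have hDpos : 0 < D := hrpos.trans_le hrD
  set θ := r / D with hθ
  have hθ0 : 0 < θ := by positivity
  have hθ1 : θ ≤ 1 := (div_le_one hDpos).2 hrD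
  have hθD : θ * D = r := div_mul_cancel₀ _ hDpos.ne'
  have hu : ‖zstar + θ • (p - zstar) - zstar‖ = r := by
    rw [add_sub_cancel_left, norm_smul, Real.norm_eq_abs, abs_of_pos hθ0, ← hDdef, hθD]
  have hterm : ∀ i, f i (zstar + θ • (p - zstar)) - f i zstar - K * (θ * B)
      ≤ θ * (f i (z i) - f i zstar) := by
    intro i
    have hdist : ‖(zstar + θ • (p - zstar)) - (zstar + θ • (z i - zstar))‖ ≤ θ * B := by
      have : (zstar + θ • (p - zstar)) - (zstar + θ • (z i - zstar)) = -(θ • (z i - p)) := by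
        module
      rw [this, norm_neg, norm_smul, Real.norm_eq_abs, abs_of_pos hθ0]
      exact mul_le_mul_of_nonneg_left (hzp i) hθ0.le
    have hθB : θ * B ≤ B := mul_le_of_le_one_left hB hθ1
    have hv : ‖zstar + θ • (z i - zstar) - zstar‖ ≤ r + B := by
      have : zstar + θ • (z i - zstar) - zstar = (zstar + θ • (p - zstar) - zstar)
        - ((zstar + θ • (p - zstar)) - (zstar + θ • (z i - zstar))) := by abel
      rw [this]
      refine (norm_sub_le _ _).trans ?_
      linarith
    have h1 := hK i _ _ (by rw [hu]; linarith) hv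
    have h2 := (hf i).2 (Set.mem_univ zstar) (Set.mem_univ (z i))
      (show 0 ≤ 1 - θ by linarith) hθ0.le (by ring)
    have h3 : (1 - θ) • zstar + θ • z i = zstar + θ • (z i - zstar) := by module
    rw [h3, smul_eq_mul, smul_eq_mul] at h2
    have h4 := mul_le_mul_of_nonneg_left hdist hK0
    linarith
  have hsum := Finset.sum_le_sum fun i (_ : i ∈ Finset.univ) => hterm i
  rw [Finset.sum_sub_distrib, sum_sub_eq_cost hn, Finset.sum_const, Finset.card_univ,
    Fintype.card_fin, nsmul_eq_mul, ← Finset.mul_sum] at hsum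
  have hcu := mul_le_mul_of_nonneg_left (hc _ hu) hn0.le
  have hfin : θ * |M| ≤ θ * ∑ i, (f i (z i) - f i zstar) := by
    have h5 : θ * (|M| + n * K * B) ≤ n * c := by
      rw [hθ, div_mul_eq_mul_div, div_le_iff₀ hDpos]
      linarith
    linarith
  exact (le_abs_self M).trans (le_of_mul_le_mul_left hfin hθ0)

/-- Expand the square. As `g i` is a subgradient at `z i` rather than at `p`, replacing `p - w` by
`z i - w` in the inner product costs at most `G * e` per agent. -/
lemma norm_sub_sq_le_of_isSubgradient (hn : 0 < n)
    {f : Fin n → EuclideanSpace ℝ (Fin d) → ℝ} {g z : Fin n → EuclideanSpace ℝ (Fin d)}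
    (hg : ∀ i, IsSubgradient (f i) (g i) (z i)) {G e a : ℝ} (hG0 : 0 ≤ G)
    (hG : ∀ i, ‖g i‖ ≤ G) {p : EuclideanSpace ℝ (Fin d)} (he : ∀ i, ‖z i - p‖ ≤ e) (ha : 0 ≤ a)
    (w : EuclideanSpace ℝ (Fin d)) :
    ‖p - (a / n) • ∑ i, g i - w‖ ^ 2
      ≤ ‖p - w‖ ^ 2 - 2 * (a / n) * ∑ i, (f i (z i) - f i w) + 2 * a * G * e + a ^ 2 * G ^ 2 := by
  have hn0 : (0 : ℝ) < n := by exact_mod_cast hn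
  have h1 : p - (a / n) • ∑ i, g i - w = (p - w) - (a / n) • ∑ i, g i := by abel
  rw [h1, norm_sub_sq_real, inner_smul_right, inner_sum]
  have h2 : ∑ i, (f i (z i) - f i w) - n * (G * e) ≤ ∑ i, inner ℝ (p - w) (g i) := by
    have : (n : ℝ) * (G * e) = ∑ _i : Fin n, G * e := by simp
    rw [this, ← Finset.sum_sub_distrib]
    refine Finset.sum_le_sum fun i _ => ?_
    have h3 := hg i w
    have h4 : inner ℝ (p - w) (g i) = -inner ℝ (g i) (w - z i) - inner ℝ (g i) (z i - p) := by
      rw [real_inner_comm, ← inner_neg_right, ← inner_sub_right]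
      congr 1
      abel
    have h5 := (real_inner_le_norm (g i) (z i - p)).trans
      (mul_le_mul (hG i) (he i) (norm_nonneg _) hG0)
    linarith
  have h6 : ‖(a / n) • ∑ i, g i‖ ^ 2 ≤ a ^ 2 * G ^ 2 := by
    rw [← mul_pow]
    refine pow_le_pow_left₀ (norm_nonneg _) ?_ 2
    rw [norm_smul, Real.norm_eq_abs, abs_of_nonneg (by positivity)]
    have : ‖∑ i, g i‖ ≤ n * G := by
      refine (norm_sum_le_of_le _ fun i _ => hG i).trans (le_of_eq ?_)
      simp
    calc a / n * ‖∑ i, g i‖ ≤ a / n * (n * G) := by gcongr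
      _ = a * G := by field_simp
  have h7 := mul_le_mul_of_nonneg_left h2 (show 0 ≤ 2 * (a / n) by positivity)
  have h8 : 2 * (a / n) * (∑ i, (f i (z i) - f i w) - n * (G * e))
      = 2 * (a / n) * ∑ i, (f i (z i) - f i w) - 2 * a * G * e := by
    field_simp
  linarith

/-! ### The algorithm as a perturbed recursion. -/

/-- The perturbation of the linear recursion `x (t + 1) = W t x t` in the algorithm. -/
noncomputable def perturbation (W : ℕ → Matrix (Fin n) (Fin n) ℝ) (α : ℕ → ℝ)
    (σ : ℕ → Fin n → ℝ) (g : ℕ → Fin n → EuclideanSpace ℝ (Fin d)) (t : ℕ) (i : Fin n) :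
    EuclideanSpace ℝ (Fin d) :=
  -∑ j, W t i j • (α t * σ t j) • g t j - (α t * (1 - σ t i)) • g t i

lemma xSeq_succ (W : ℕ → Matrix (Fin n) (Fin n) ℝ) (α : ℕ → ℝ) (σ : ℕ → Fin n → ℝ)
    (g : ℕ → Fin n → EuclideanSpace ℝ (Fin d)) (x0 : Fin n → EuclideanSpace ℝ (Fin d))
    (t : ℕ) (i : Fin n) :
    xSeq W α σ g x0 (t + 1) i
      = ∑ j, W t i j • xSeq W α σ g x0 t j + perturbation W α σ g t i := by
  simp only [xSeq, perturbation, smul_sub, Finset.sum_sub_distrib]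
  abel

/-- Unit column sums make a subgradient contribute equally to the total whether it is applied before
or after mixing, so `σ` disappears. -/
lemma sum_perturbation {W : ℕ → Matrix (Fin n) (Fin n) ℝ} (h1 : ∀ t j, ∑ i, W t i j = 1)
    (α : ℕ → ℝ) (σ : ℕ → Fin n → ℝ) (g : ℕ → Fin n → EuclideanSpace ℝ (Fin d)) (t : ℕ) :
    ∑ i, perturbation W α σ g t i = -(α t • ∑ i, g t i) := by
  simp only [perturbation, Finset.sum_sub_distrib, Finset.sum_neg_distrib]
  rw [Finset.sum_comm]
  simp only [← Finset.sum_smul, h1, one_smul]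
  rw [← Finset.sum_neg_distrib, ← Finset.sum_sub_distrib, Finset.smul_sum,
    ← Finset.sum_neg_distrib]
  exact Finset.sum_congr rfl fun i _ => by module

lemma sum_norm_perturbation_le {W : ℕ → Matrix (Fin n) (Fin n) ℝ} (h0 : ∀ t i j, 0 ≤ W t i j)
    (h1 : ∀ t j, ∑ i, W t i j = 1) {α : ℕ → ℝ} {σ : ℕ → Fin n → ℝ}
    {g : ℕ → Fin n → EuclideanSpace ℝ (Fin d)} {t : ℕ} {G : ℝ} (hα : 0 ≤ α t)
    (hσ : ∀ i, σ t i = 0 ∨ σ t i = 1) (hG : ∀ i, ‖g t i‖ ≤ G) :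
    ∑ i, ‖perturbation W α σ g t i‖ ≤ 2 * n * G * α t := by
  have hc : ∀ c : ℝ, 0 ≤ c → c ≤ 1 → ∀ i, ‖(α t * c) • g t i‖ ≤ α t * G := by
    intro c hc0 hc1 i
    rw [norm_smul, Real.norm_eq_abs, abs_of_nonneg (by positivity)]
    exact mul_le_mul (mul_le_of_le_one_right hα hc1) (hG i) (norm_nonneg _) hα
  have h2 : ∀ i, ‖perturbation W α σ g t i‖ ≤ ∑ j, W t i j * (α t * G) + α t * G := by
    intro i
    refine (norm_sub_le _ _).trans (add_le_add ?_ ?_)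
    · rw [norm_neg]
      refine norm_sum_le_of_le _ fun j _ => ?_
      rw [norm_smul, Real.norm_eq_abs, abs_of_nonneg (h0 t i j)]
      refine mul_le_mul_of_nonneg_left (hc _ ?_ ?_ j) (h0 t i j) <;>
        rcases hσ j with h | h <;> simp [h]
    · refine hc _ ?_ ?_ i <;> rcases hσ i with h | h <;> simp [h]
  refine (Finset.sum_le_sum fun i _ => h2 i).trans (le_of_eq ?_)
  rw [Finset.sum_add_distrib, Finset.sum_comm]
  simp only [← Finset.sum_mul, h1, one_mul, Finset.sum_const, Finset.card_univ, Fintype.card_fin,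
    nsmul_eq_mul]
  ring

/-! ### Boundedness of the run and the summed optimality gap. -/

/-- The main estimate: the weighted sum of the optimality gaps over a finite horizon is bounded
by a constant that depends on neither the horizon nor the run. -/
theorem exists_sum_gap_le (hn : 0 < n) {f : Fin n → EuclideanSpace ℝ (Fin d) → ℝ}
    (hf : ∀ i, ConvexOn ℝ Set.univ (f i)) (hZ : Bornology.IsBounded (optimalSet f))
    {zstar : EuclideanSpace ℝ (Fin d)} (hzstar : zstar ∈ optimalSet f)
    {𝔾 : ℕ → Digraph (Fin n)} (hself : ∀ t i, (𝔾 t).Adj i i)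
    (hconn : UniformlyStronglyConnected 𝔾) {W : ℕ → Matrix (Fin n) (Fin n) ℝ}
    (hW : PushSumWeights 𝔾 W) (x0 : Fin n → EuclideanSpace ℝ (Fin d)) {G A : ℝ}
    (hG0 : 0 ≤ G) (hA0 : 0 ≤ A) :
    ∃ C : ℝ, 0 ≤ C ∧ ∀ (T : ℕ) (α : ℕ → ℝ), (∀ t < T, 0 ≤ α t) → (∀ t < T, α t ≤ A) →
      (∀ s t, s ≤ t → t < T → α t ≤ α s) →
      ∀ σ : ℕ → Fin n → ℝ, (∀ t < T, ∀ i, σ t i = 0 ∨ σ t i = 1) →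
      ∀ g : ℕ → Fin n → EuclideanSpace ℝ (Fin d),
        (∀ t < T, ∀ i, IsSubgradient (f i) (g t i) (zSeq W α σ g x0 t i)) →
        (∀ t < T, ∀ i, ‖g t i‖ ≤ G) →
      ∀ v : ℕ → EuclideanSpace ℝ (Fin d),
        (∀ t p r, (∀ i, ‖zSeq W α σ g x0 t i - p‖ ≤ r) → ‖v t - p‖ ≤ r) →
        ∑ t ∈ Finset.range T, α t * (cost f (v t) - cost f zstar)
          ≤ C * (1 + ∑ t ∈ Finset.range T, α t ^ 2) := by
  have hn0 : (0 : ℝ) < n := by exact_mod_cast hn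
  have h0 := hW.nonneg
  have h1 := hW.column_sum
  obtain ⟨hy, ρ, hρ0, ⟨R, hR⟩, hρ⟩ := exists_mixing_rate hn hself hconn hW
  have hρR : ∀ k, ρ k ≤ R := fun k =>
    (Finset.single_le_sum (fun k _ => hρ0 k) (Finset.self_mem_range_succ k)).trans (hR (k + 1))
  have hR0 : 0 ≤ R := (hρ0 0).trans (hρR 0)
  set X := ∑ j, ‖x0 j‖ with hX
  have hX0 : 0 ≤ X := Finset.sum_nonneg fun _ _ => norm_nonneg _
  set B := R * X + 2 * n * G * (R * A) with hB
  have hB0 : 0 ≤ B := by positivity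
  -- `B` will bound the disagreement `e`. The threshold is what makes the descent term absorb `2 α G
  -- B + α² G²`, so the distance does not increase beyond `D`; within `D`, one step adds at most `A
  -- * G`, whence `Q`.
  obtain ⟨D, hD⟩ := exists_radius_le_sum hn hf hZ hzstar hB0 (n * (G * B + A * G ^ 2 / 2))
  set Q := max ‖(1 / (n : ℝ)) • ∑ i, x0 i - zstar‖ (|D| + A * G) with hQ
  have hQ0 : 0 ≤ Q := (norm_nonneg _).trans (le_max_left _ _)
  obtain ⟨K, hK0, hK⟩ := exists_lipschitz_of_convexOn hf zstar (Q + B)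
  have hKcost : ∀ u v, ‖u - zstar‖ ≤ Q + B → ‖v - zstar‖ ≤ Q + B →
      cost f u - cost f v ≤ K * ‖u - v‖ := by
    intro u v hu hv
    have := Finset.sum_le_sum fun i (_ : i ∈ Finset.univ) => hK i u v hu hv
    rw [sum_sub_eq_cost hn, Finset.sum_const, Finset.card_univ, Fintype.card_fin,
      nsmul_eq_mul] at this
    exact le_of_mul_le_mul_left this hn0
  -- `Q ^ 2` comes from telescoping and `G ^ 2` from the squared steps. In the factor of `∑ α e`, `2
  -- * G` comes from the descent inequality and `4 * K` from moving both `zᵢ` and `v` to `p`.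
  refine ⟨(Q ^ 2 + G ^ 2 + (2 * G + 4 * K) * (A * X * R + 2 * n * G * R)) / 2, by positivity, ?_⟩
  intro T α hα hαA hanti σ hσ g hg hG v hv
  set x := xSeq W α σ g x0 with hx
  set p : ℕ → EuclideanSpace ℝ (Fin d) := fun t => (1 / (n : ℝ)) • ∑ i, x t i with hp
  set e : ℕ → ℝ := fun t => ρ t * X
    + 2 * n * G * ∑ s ∈ Finset.range t, ρ (t - 1 - s) * α s with he
  have hpsucc : ∀ t, p (t + 1) = p t - (α t / n) • ∑ i, g t i := by
    intro t
    simp only [hp]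
    rw [sum_eq_sum_add_sum h1 (xSeq_succ W α σ g x0), sum_perturbation h1]
    module
  have hze : ∀ t < T, ∀ i, ‖zSeq W α σ g x0 t i - p t‖ ≤ e t := by
    intro t ht i
    refine (norm_ratio_sub_mean_le h1 hy hρ (xSeq_succ W α σ g x0) t i).trans ?_
    refine add_le_add le_rfl ?_
    rw [Finset.mul_sum]
    refine Finset.sum_le_sum fun s hs => ?_
    have hsT : s < T := (Finset.mem_range.1 hs).trans ht
    have := mul_le_mul_of_nonneg_left
      (sum_norm_perturbation_le h0 h1 (hα s hsT) (hσ s hsT) (hG s hsT)) (hρ0 (t - 1 - s))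
    linarith
  have heB : ∀ t < T, e t ≤ B := by
    intro t ht
    have h2 : ∑ s ∈ Finset.range t, ρ (t - 1 - s) * α s ≤ R * A := by
      calc ∑ s ∈ Finset.range t, ρ (t - 1 - s) * α s
          ≤ ∑ s ∈ Finset.range t, ρ (t - 1 - s) * A := Finset.sum_le_sum fun s hs =>
            mul_le_mul_of_nonneg_left (hαA s ((Finset.mem_range.1 hs).trans ht)) (hρ0 _)
        _ = (∑ s ∈ Finset.range t, ρ s) * A := by
            rw [← Finset.sum_mul, Finset.sum_range_reflect]
        _ ≤ R * A := mul_le_mul_of_nonneg_right (hR t) hA0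
    exact add_le_add (mul_le_mul_of_nonneg_right (hρR t) hX0)
      (mul_le_mul_of_nonneg_left h2 (by positivity))
  -- The bound `b` is left free: `B` serves the boundedness induction, `e t` the final summation.
  have hdesc : ∀ t < T, ∀ b, e t ≤ b → ‖p (t + 1) - zstar‖ ^ 2 ≤ ‖p t - zstar‖ ^ 2
      - 2 * (α t / n) * ∑ i, (f i (zSeq W α σ g x0 t i) - f i zstar) + 2 * α t * G * b
      + α t ^ 2 * G ^ 2 := by
    intro t ht b hb
    rw [hpsucc]
    exact norm_sub_sq_le_of_isSubgradient hn (hg t ht) hG0 (hG t ht)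
      (fun i => (hze t ht i).trans hb) (hα t ht) zstar
  have hbdd : ∀ t ≤ T, ‖p t - zstar‖ ≤ Q := by
    intro t
    induction t with
    | zero => exact fun _ => le_max_left _ _
    | succ t ih =>
      intro ht
      have htT : t < T := ht
      have hat := hα t htT
      rcases le_total D ‖p t - zstar‖ with hc | hc
      · have h2 := hD (p t) _ (fun i => (hze t htT i).trans (heB t htT)) hc
        have h3 := hdesc t htT B (heB t htT)
        have h4 := mul_le_mul_of_nonneg_left h2 (show 0 ≤ 2 * (α t / n) by positivity)
        have h5 : 2 * (α t / n) * (n * (G * B + A * G ^ 2 / 2))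
            = 2 * α t * G * B + α t * A * G ^ 2 := by field_simp
        have h6 : α t ^ 2 * G ^ 2 ≤ α t * A * G ^ 2 := by
          rw [sq (α t)]
          exact mul_le_mul_of_nonneg_right (mul_le_mul_of_nonneg_left (hαA t htT) hat)
            (sq_nonneg G)
        exact (le_of_sq_le_sq (by linarith) (norm_nonneg _)).trans (ih htT.le)
      · refine le_trans ?_ (le_max_right _ _)
        have h2 : p (t + 1) - zstar = (p t - zstar) - (α t / n) • ∑ i, g t i := by
          rw [hpsucc]; abel
        have h3 : ‖∑ i, g t i‖ ≤ n * G := by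
          refine (norm_sum_le_of_le _ fun i _ => hG t htT i).trans (le_of_eq ?_)
          simp
        have h4 : ‖(α t / n) • ∑ i, g t i‖ ≤ A * G := by
          rw [norm_smul, Real.norm_eq_abs, abs_of_nonneg (by positivity)]
          calc α t / n * ‖∑ i, g t i‖ ≤ α t / n * (n * G) := by gcongr
            _ = α t * G := by field_simp
            _ ≤ A * G := mul_le_mul_of_nonneg_right (hαA t htT) hG0
        rw [h2]
        exact (norm_sub_le _ _).trans (add_le_add (hc.trans (le_abs_self D)) h4)
  have hball : ∀ t < T, ∀ u, ‖u - p t‖ ≤ e t → ‖u - zstar‖ ≤ Q + B := by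
    intro t ht u hu
    have := norm_sub_le_norm_sub_add_norm_sub u (p t) zstar
    linarith [hbdd t ht.le, heB t ht]
  have hstep : ∀ t ∈ Finset.range T, 2 * (α t * (cost f (v t) - cost f zstar))
      ≤ (‖p t - zstar‖ ^ 2 - ‖p (t + 1) - zstar‖ ^ 2) + α t ^ 2 * G ^ 2
        + (2 * G + 4 * K) * (α t * e t) := by
    intro t ht
    have htT := Finset.mem_range.1 ht
    have hat := hα t htT
    have hpb : ‖p t - zstar‖ ≤ Q + B := by linarith [hbdd t htT.le]
    have hve := hv t (p t) (e t) (hze t htT)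
    have h2 : cost f (v t) - cost f (p t) ≤ K * e t :=
      (hKcost _ _ (hball t htT _ hve) hpb).trans (mul_le_mul_of_nonneg_left hve hK0)
    have h3 : n * (cost f (p t) - cost f zstar) - n * (K * e t)
        ≤ ∑ i, (f i (zSeq W α σ g x0 t i) - f i zstar) := by
      have : (n : ℝ) * (K * e t) = ∑ _i : Fin n, K * e t := by simp
      rw [this, ← sum_sub_eq_cost hn, ← Finset.sum_sub_distrib]
      refine Finset.sum_le_sum fun i _ => ?_
      have hzi := hze t htT i
      have h4 := hK i (p t) _ hpb (hball t htT _ hzi)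
      rw [norm_sub_rev] at h4
      linarith [mul_le_mul_of_nonneg_left hzi hK0]
    have h5 := mul_le_mul_of_nonneg_left h3 (show 0 ≤ 2 * (α t / n) by positivity)
    have h6 : 2 * (α t / n) * (n * (cost f (p t) - cost f zstar) - n * (K * e t))
        = 2 * α t * (cost f (p t) - cost f zstar) - 2 * K * (α t * e t) := by field_simp
    have h7 := mul_le_mul_of_nonneg_left h2 (show 0 ≤ 2 * α t by positivity)
    linarith [hdesc t htT (e t) le_rfl]
  have hsum := Finset.sum_le_sum hstep
  rw [← Finset.mul_sum, Finset.sum_add_distrib, Finset.sum_add_distrib, Finset.sum_range_sub',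
    ← Finset.sum_mul, ← Finset.mul_sum] at hsum
  have hS0 : 0 ≤ ∑ t ∈ Finset.range T, α t ^ 2 := Finset.sum_nonneg fun _ _ => sq_nonneg _
  have hαe : ∑ t ∈ Finset.range T, α t * e t
      ≤ A * X * R + 2 * n * G * R * ∑ t ∈ Finset.range T, α t ^ 2 := by
    have h2 : ∑ t ∈ Finset.range T, α t * e t = ∑ t ∈ Finset.range T, α t * ρ t * X
        + 2 * n * G * ∑ t ∈ Finset.range T,
          α t * ∑ s ∈ Finset.range t, ρ (t - 1 - s) * α s := by
      rw [Finset.mul_sum, ← Finset.sum_add_distrib]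
      exact Finset.sum_congr rfl fun t _ => by simp only [he]; ring
    have h3 : ∑ t ∈ Finset.range T, α t * ρ t * X ≤ A * X * R := by
      calc ∑ t ∈ Finset.range T, α t * ρ t * X ≤ ∑ t ∈ Finset.range T, A * X * ρ t := by
            refine Finset.sum_le_sum fun t ht => ?_
            have := mul_le_mul_of_nonneg_right (hαA t (Finset.mem_range.1 ht))
              (mul_nonneg (hρ0 t) hX0)
            linarith
        _ ≤ A * X * R := by
            rw [← Finset.mul_sum]
            exact mul_le_mul_of_nonneg_left (hR T) (by positivity)
    have h4 := mul_le_mul_of_nonneg_left (sum_mul_sum_kernel_le hα hanti hρ0 hR)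
      (show 0 ≤ 2 * n * G by positivity)
    rw [h2]
    linarith
  have hp0 : ‖p 0 - zstar‖ ^ 2 ≤ Q ^ 2 :=
    pow_le_pow_left₀ (norm_nonneg _) (hbdd 0 (Nat.zero_le T)) 2
  have hpT : 0 ≤ ‖p T - zstar‖ ^ 2 := sq_nonneg _
  have hfin := mul_le_mul_of_nonneg_left hαe (show 0 ≤ 2 * G + 4 * K by positivity)
  set S := ∑ t ∈ Finset.range T, α t ^ 2
  -- These are cross terms in the expansion of `C * (1 + S)` that the estimate does not need.
  have hr1 : 0 ≤ Q ^ 2 * S := by positivity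
  have hr2 : 0 ≤ (2 * G + 4 * K) * (A * X * R) * S := by positivity
  have hr3 : 0 ≤ (2 * G + 4 * K) * (2 * n * G * R) := by positivity
  linarith [sq_nonneg G]

/-! ### From summed gaps to averaged iterates. -/

lemma norm_zBar_sub_le (hn : 0 < n) {W : ℕ → Matrix (Fin n) (Fin n) ℝ} {α : ℕ → ℝ}
    {σ : ℕ → Fin n → ℝ} {g : ℕ → Fin n → EuclideanSpace ℝ (Fin d)}
    {x0 : Fin n → EuclideanSpace ℝ (Fin d)} {t : ℕ} {p : EuclideanSpace ℝ (Fin d)} {r : ℝ}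
    (h : ∀ i, ‖zSeq W α σ g x0 t i - p‖ ≤ r) : ‖zBar W α σ g x0 t - p‖ ≤ r := by
  have hn0 : (0 : ℝ) < n := by exact_mod_cast hn
  have h1 : zBar W α σ g x0 t - p = (1 / (n : ℝ)) • ∑ i, (zSeq W α σ g x0 t i - p) := by
    rw [zBar, Finset.sum_sub_distrib, smul_sub, Finset.sum_const, Finset.card_univ,
      Fintype.card_fin, ← Nat.cast_smul_eq_nsmul ℝ, smul_smul, one_div_mul_cancel hn0.ne',
      one_smul]
  rw [h1, norm_smul, Real.norm_eq_abs, abs_of_pos (by positivity), one_div_mul_eq_div,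
    div_le_iff₀ hn0]
  refine (norm_sum_le_of_le _ fun i _ => h i).trans (le_of_eq ?_)
  simp [mul_comm]

lemma cost_weightedAvg_sub_le {f : Fin n → EuclideanSpace ℝ (Fin d) → ℝ}
    (hf : ∀ i, ConvexOn ℝ Set.univ (f i)) {α : ℕ → ℝ} {m : ℕ} (hα : ∀ t < m, 0 ≤ α t)
    (hpos : 0 < ∑ τ ∈ Finset.range m, α τ) (u : ℕ → EuclideanSpace ℝ (Fin d)) (c : ℝ) :
    cost f (weightedAvg α u m) - c
      ≤ (∑ τ ∈ Finset.range m, α τ)⁻¹ * ∑ τ ∈ Finset.range m, α τ * (cost f (u τ) - c) := by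
  have h := (cost_convexOn hf).map_centerMass_le (t := Finset.range m) (w := α) (p := u)
    (fun t ht => hα t (Finset.mem_range.1 ht)) hpos (fun _ _ => trivial)
  simp only [Finset.centerMass, smul_eq_mul, Function.comp] at h
  simp only [mul_sub, Finset.sum_sub_distrib, ← Finset.sum_mul]
  rw [inv_mul_cancel_left₀ hpos.ne']
  exact sub_le_sub_right h c

lemma weightedAvg_eq_uniformAvg {α : ℕ → ℝ} {a : ℝ} (ha : a ≠ 0) {m : ℕ}
    (hα : ∀ t < m, α t = a) (u : ℕ → EuclideanSpace ℝ (Fin d)) :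
    weightedAvg α u m = uniformAvg u m := by
  have h1 : ∑ τ ∈ Finset.range m, α τ = m * a := by
    rw [Finset.sum_congr rfl fun t ht => hα t (Finset.mem_range.1 ht)]
    simp
  have h2 : ∑ τ ∈ Finset.range m, α τ • u τ = a • ∑ τ ∈ Finset.range m, u τ := by
    rw [Finset.smul_sum]
    exact Finset.sum_congr rfl fun t ht => by rw [hα t (Finset.mem_range.1 ht)]
  rw [weightedAvg, uniformAvg, h1, h2, smul_smul, mul_inv, inv_mul_cancel_right₀ ha]

lemma tendsto_cost_weightedAvg {f : Fin n → EuclideanSpace ℝ (Fin d) → ℝ}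
    (hf : ∀ i, ConvexOn ℝ Set.univ (f i)) {zstar : EuclideanSpace ℝ (Fin d)}
    (hzstar : zstar ∈ optimalSet f) {α : ℕ → ℝ} (hα : DiminishingSteps α) {C : ℝ} (hC : 0 ≤ C)
    {u : ℕ → EuclideanSpace ℝ (Fin d)}
    (hu : ∀ T, ∑ t ∈ Finset.range T, α t * (cost f (u t) - cost f zstar)
      ≤ C * (1 + ∑ t ∈ Finset.range T, α t ^ 2)) :
    Tendsto (fun t : ℕ => cost f (weightedAvg α u (t + 1))) atTop (𝓝 (cost f zstar)) := by
  have hlim : Tendsto (fun t : ℕ => cost f zstar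
      + (∑ τ ∈ Finset.range (t + 1), α τ)⁻¹ * (C * (1 + ∑' t, α t ^ 2))) atTop
      (𝓝 (cost f zstar)) := by
    have := (((tendsto_inv_atTop_zero.comp hα.sum_eq_top).comp (tendsto_add_atTop_nat 1)).mul_const
      (C * (1 + ∑' t, α t ^ 2))).const_add (cost f zstar)
    simpa using this
  refine tendsto_of_tendsto_of_tendsto_of_le_of_le tendsto_const_nhds hlim
    (fun t => hzstar _) fun t => ?_
  have hpos : 0 < ∑ τ ∈ Finset.range (t + 1), α τ :=
    Finset.sum_pos (fun τ _ => hα.pos τ) (by simp)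
  have h1 := cost_weightedAvg_sub_le hf (fun τ _ => (hα.pos τ).le) hpos u (cost f zstar)
  have h2 : C * (1 + ∑ τ ∈ Finset.range (t + 1), α τ ^ 2) ≤ C * (1 + ∑' t, α t ^ 2) := by
    have := hα.summable_sq.sum_le_tsum (Finset.range (t + 1)) fun τ _ => sq_nonneg (α τ)
    gcongr
  have h3 := mul_le_mul_of_nonneg_left ((hu (t + 1)).trans h2) (inv_nonneg.2 hpos.le)
  dsimp only
  linarith

/-- With this step size ∑ α = √T and ∑ α² = 1, so Jensen's inequality gives the bound C (1 + 1) /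
√T. -/
lemma cost_uniformAvg_sub_le {f : Fin n → EuclideanSpace ℝ (Fin d) → ℝ}
    (hf : ∀ i, ConvexOn ℝ Set.univ (f i)) {T : ℕ} (hT : 0 < T) {α : ℕ → ℝ}
    (hα : ∀ t < T, α t = 1 / Real.sqrt T) {C c : ℝ} {u : ℕ → EuclideanSpace ℝ (Fin d)}
    (hu : ∑ t ∈ Finset.range T, α t * (cost f (u t) - c)
      ≤ C * (1 + ∑ t ∈ Finset.range T, α t ^ 2)) :
    cost f (uniformAvg u T) - c ≤ 2 * C / Real.sqrt T := by
  have hT0 : (0 : ℝ) < T := by exact_mod_cast hT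
  have hs : 0 < Real.sqrt T := Real.sqrt_pos.2 hT0
  have h1 : ∑ t ∈ Finset.range T, α t = Real.sqrt T := by
    rw [Finset.sum_congr rfl fun t ht => hα t (Finset.mem_range.1 ht), Finset.sum_const,
      Finset.card_range, nsmul_eq_mul, mul_one_div, Real.div_sqrt]
  have h2 : ∑ t ∈ Finset.range T, α t ^ 2 = 1 := by
    rw [Finset.sum_congr rfl fun t ht => by rw [hα t (Finset.mem_range.1 ht)], Finset.sum_const,
      Finset.card_range, nsmul_eq_mul, div_pow, one_pow, Real.sq_sqrt hT0.le,
      mul_one_div_cancel hT0.ne']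
  have h3 := cost_weightedAvg_sub_le hf (α := α) (fun t ht => by rw [hα t ht]; positivity)
    (by rw [h1]; exact hs) u c
  rw [weightedAvg_eq_uniformAvg (by positivity) hα, h1] at h3
  rw [h2] at hu
  refine h3.trans ?_
  rw [inv_mul_eq_div]
  exact div_le_div_of_nonneg_right (by linarith) hs.le

end HeterogeneousSubgradient

theorem theorem1 {n d : ℕ} (hn : 0 < n)
    (f : Fin n → EuclideanSpace ℝ (Fin d) → ℝ)
    (hf : ∀ i, ConvexOn ℝ Set.univ (f i))
    (hZ : Bornology.IsBounded (optimalSet f))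
    (zstar : EuclideanSpace ℝ (Fin d)) (hzstar : zstar ∈ optimalSet f)
    (𝔾 : ℕ → Digraph (Fin n))
    (hself : ∀ t i, (𝔾 t).Adj i i)
    (hconn : UniformlyStronglyConnected 𝔾)
    (W : ℕ → Matrix (Fin n) (Fin n) ℝ) (hW : PushSumWeights 𝔾 W)
    (x0 : Fin n → EuclideanSpace ℝ (Fin d)) :
    (∀ α : ℕ → ℝ, DiminishingSteps α →
      ∀ σ : ℕ → Fin n → ℝ, (∀ t i, σ t i = 0 ∨ σ t i = 1) →
      ∀ g : ℕ → Fin n → EuclideanSpace ℝ (Fin d),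
        (∀ t i, IsSubgradient (f i) (g t i) (zSeq W α σ g x0 t i)) →
        (∃ G : ℝ, ∀ t i, ‖g t i‖ ≤ G) →
        Tendsto (fun t : ℕ => cost f (weightedAvg α (zBar W α σ g x0) (t + 1)))
          atTop (𝓝 (cost f zstar)) ∧
        ∀ k : Fin n,
          Tendsto
            (fun t : ℕ => cost f (weightedAvg α (fun τ => zSeq W α σ g x0 τ k) (t + 1)))
            atTop (𝓝 (cost f zstar))) ∧
    (∀ G : ℝ, ∃ C : ℝ, ∀ T : ℕ, 0 < T →
      ∀ α : ℕ → ℝ, (∀ t < T, α t = 1 / Real.sqrt T) →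
      ∀ σ : ℕ → Fin n → ℝ, (∀ t < T, ∀ i, σ t i = 0 ∨ σ t i = 1) →
      ∀ g : ℕ → Fin n → EuclideanSpace ℝ (Fin d),
        (∀ t < T, ∀ i, IsSubgradient (f i) (g t i) (zSeq W α σ g x0 t i)) →
        (∀ t < T, ∀ i, ‖g t i‖ ≤ G) →
        cost f (uniformAvg (zBar W α σ g x0) T) - cost f zstar ≤ C / Real.sqrt T ∧
        ∀ k : Fin n,
          cost f (uniformAvg (fun τ => zSeq W α σ g x0 τ k) T) - cost f zstar
            ≤ C / Real.sqrt T) := by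
  refine ⟨fun α hα σ hσ g hg ⟨G, hG⟩ => ?_, fun G => ?_⟩
  -- The step sizes are bounded by `α 0` here and by `1` in the second part, where `1 / √T ≤ 1`
  -- keeps the constant independent of `T`. The sign of `G` is not assumed, hence `|G|`.
  · obtain ⟨C, hC, h⟩ := exists_sum_gap_le hn hf hZ hzstar hself hconn hW x0 (abs_nonneg G)
      (hα.pos 0).le
    have hgap := fun v hv T => h T α (fun t _ => (hα.pos t).le)
      (fun t _ => hα.antitone (Nat.zero_le t)) (fun s t hst _ => hα.antitone hst) σ
      (fun t _ => hσ t) g (fun t _ => hg t) (fun t _ i => (hG t i).trans (le_abs_self G)) v hv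
    exact ⟨tendsto_cost_weightedAvg hf hzstar hα hC
        (hgap _ fun t p r hr => norm_zBar_sub_le hn hr),
      fun k => tendsto_cost_weightedAvg hf hzstar hα hC (hgap _ fun t p r hr => hr k)⟩
  · obtain ⟨C, hC, h⟩ := exists_sum_gap_le hn hf hZ hzstar hself hconn hW x0 (abs_nonneg G)
      zero_le_one
    refine ⟨2 * C, fun T hT α hα σ hσ g hg hG => ?_⟩
    have hT1 : 1 ≤ Real.sqrt T := Real.one_le_sqrt.2 (by exact_mod_cast hT)
    have hgap := h T α (fun t ht => by rw [hα t ht]; positivity)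
      (fun t ht => by rw [hα t ht]; exact (div_le_one (by linarith)).2 hT1)
      (fun s t hst ht => by rw [hα t ht, hα s (hst.trans_lt ht)]) σ hσ g hg
      (fun t ht i => (hG t ht i).trans (le_abs_self G))
    exact ⟨cost_uniformAvg_sub_le hf hT hα (hgap _ fun t p r hr => norm_zBar_sub_le hn hr),
      fun k => cost_uniformAvg_sub_le hf hT hα (hgap _ fun t p r hr => hr k)⟩
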